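/- Let $n>1$, let $\phi:\mathbb{R}^n\to\mathbb{R}$ be continuously differentiable with $L$-Lipschitz gradient ($L>0$, Euclidean norms), and let $f:\mathbb{R}^n\to\mathbb{R}$ be a measurable function with $|f(y)-\phi(y)|\le\epsilon_f$ for all $y\in\mathbb{R}^n$, where $\epsilon_f\ge 0$ is a constant. Let $x\in\mathbb{R}^n$, $\theta\in(0,1)$, $\delta\in(0,1)$, $\sigma>0$, and let $u_1,\dots,u_N$ be independent random vectors with the standard normal distribution $\mathcal{N}(0,I)$ on $\mathbb{R}^n$. Let $$g(x)=\frac1N\sum_{i=1}^N\frac{f(x+\sigma u_i)-f(x)}{\sigma}\,u_i$$ be the Gaussian smoothed gradient (GSG) estimate. Suppose that $$N\ \ge\ \frac{3n}{\delta\theta^2}\,\frac{n}{(\sqrt n-1)^2}+\frac{n+4}{16\delta}+\frac1\delta,$$ $$\sqrt{\frac{\epsilon_f}{L}}\ \le\ \sigma\ \le\ \frac{\theta\|\nabla\phi(x)\|}{6nL},\qquad \|\nabla\phi(x)\|\ \ge\ \frac{6n\sqrt{L\epsilon_f}}{\theta}.$$ Then, with probability at least $1-\delta$, the norm condition $$\|g(x)-\nabla\phi(x)\|\le\theta\,\|\nabla\phi(x)\|$$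 holds. -/

import Mathlib

open scoped NNReal

/-- The Gaussian smoothed gradient (GSG) of `f` at `x` with sampling radius `σ` and sampling
directions `u 0, …, u (N - 1)`:
`g(x) = (1 / N) ∑ i, ((f (x + σ u i) - f x) / σ) u i`. -/
noncomputable def gaussianSmoothedGradient {n N : ℕ} (f : EuclideanSpace ℝ (Fin n) → ℝ)
    (σ : ℝ) (u : Fin N → EuclideanSpace ℝ (Fin n)) (x : EuclideanSpace ℝ (Fin n)) :
    EuclideanSpace ℝ (Fin n) :=
  (1 / (N : ℝ)) • ∑ i, ((f (x + σ • u i) - f x) / σ) • u i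

/-- The norm condition `‖g - ∇φ(x)‖ ≤ θ ‖∇φ(x)‖` for a gradient estimate `g` at `x`. -/
def NormCondition {n : ℕ} (φ : EuclideanSpace ℝ (Fin n) → ℝ) (θ : ℝ)
    (g x : EuclideanSpace ℝ (Fin n)) : Prop :=
  ‖g - gradient φ x‖ ≤ θ * ‖gradient φ x‖

/-!
The weight of `u` in the estimate, `(f (x + σ u) - f x) / σ`, differs from `⟪∇φ x, u⟫` by at most
`L σ (‖u‖² / 2 + 1)` and a constant. As `⟪v, u⟫ u` has mean `v`, the bias is the mean of `r(u) u`
with `r` that remainder, and Bessel's inequality for the coordinates of `u`, which are orthonormal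
in `L²`, bounds it by the `L²` norm of `r`, hence by `L σ (n + 3) / 2`. Chebyshev's inequality
controls the deviation from the mean: the second moment of a summand is bounded by a combination of
`E[⟪v, u⟫² ‖u‖²]` and `E‖u‖ᵏ`, `k ≤ 6`, which Gaussian integration by parts evaluates.
-/

namespace GaussianSmoothing

open MeasureTheory ProbabilityTheory Real Module
open scoped RealInnerProductSpace

section SteinIdentity

variable {E : Type*} [NormedAddCommGroup E] [InnerProductSpace ℝ E]

/-- The density of the standard Gaussian measure of `E` with respect to its volume. -/
noncomputable def stdGaussianPDFReal (u : E) : ℝ :=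
  (2 * π) ^ (-(finrank ℝ E : ℝ) / 2) * exp (-‖u‖ ^ 2 / 2)

lemma stdGaussianPDFReal_nonneg (u : E) : 0 ≤ stdGaussianPDFReal u := by
  unfold stdGaussianPDFReal
  positivity

lemma continuous_stdGaussianPDFReal : Continuous (stdGaussianPDFReal : E → ℝ) := by
  unfold stdGaussianPDFReal
  fun_prop

lemma hasFDerivAt_stdGaussianPDFReal (u : E) :
    HasFDerivAt stdGaussianPDFReal (-(stdGaussianPDFReal u • innerSL ℝ u)) u := by
  have h := (((hasStrictFDerivAt_norm_sq u).hasFDerivAt.const_mul (-1 / 2)).exp).const_mul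
    ((2 * π) ^ (-(finrank ℝ E : ℝ) / 2))
  convert! h using 1
  · ext w
    simp only [stdGaussianPDFReal]
    ring_nf
  · ext w
    simp only [stdGaussianPDFReal, neg_apply, smul_apply,
      innerSL_apply_apply, smul_eq_mul, nsmul_eq_mul, Nat.cast_ofNat]
    ring_nf

variable [FiniteDimensional ℝ E] [MeasurableSpace E] [BorelSpace E]

lemma integrable_stdGaussianPDFReal : Integrable (stdGaussianPDFReal : E → ℝ) := by
  have h := (GaussianFourier.integrable_cexp_neg_mul_sq_norm_add (b := (1 / 2 : ℝ)) (by simp) 0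
    (0 : E)).norm.const_mul ((2 * π) ^ (-(finrank ℝ E : ℝ) / 2))
  refine h.congr (ae_of_all _ fun u ↦ ?_)
  have hre : (-((1 / 2 : ℝ) : ℂ) * ‖u‖ ^ 2 + 0 * ⟪(0 : E), u⟫).re = -‖u‖ ^ 2 / 2 := by
    rw [zero_mul, add_zero, ← Complex.ofReal_pow, ← Complex.ofReal_neg, ← Complex.ofReal_mul,
      Complex.ofReal_re]
    ring
  simp only [stdGaussianPDFReal, Complex.norm_exp, hre]

lemma integral_stdGaussianPDFReal_smul_cexp (t : E) :
    ∫ u, stdGaussianPDFReal u • Complex.exp (⟪u, t⟫ * Complex.I) = Complex.exp (-‖t‖ ^ 2 / 2) := by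
  have h := GaussianFourier.integral_cexp_neg_mul_sq_norm_add (b := 1 / 2) (by simp) Complex.I t
  have hc : ((2 * π) ^ (-(finrank ℝ E : ℝ) / 2) : ℝ) * ((π : ℂ) / (1 / 2)) ^ (finrank ℝ E / 2 : ℂ)
      = 1 := by
    have hbase : (π : ℂ) / (1 / 2) = ((2 * π : ℝ) : ℂ) := by
      push_cast
      ring
    have hexp : (finrank ℝ E / 2 : ℂ) = ((finrank ℝ E / 2 : ℝ) : ℂ) := by push_cast; rfl
    rw [hbase, hexp, ← Complex.ofReal_cpow (by positivity), ← Complex.ofReal_mul,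
      ← rpow_add (by positivity), neg_div, neg_add_cancel, rpow_zero, Complex.ofReal_one]
  calc ∫ u, stdGaussianPDFReal u • Complex.exp (⟪u, t⟫ * Complex.I)
      = ((2 * π) ^ (-(finrank ℝ E : ℝ) / 2) : ℝ) *
          ∫ u : E, Complex.exp (-(1 / 2) * ‖u‖ ^ 2 + Complex.I * ⟪t, u⟫) := by
        rw [← integral_const_mul]
        congr with u
        rw [Complex.exp_add, stdGaussianPDFReal, real_inner_comm, Complex.real_smul]
        push_cast
        ring_nf
    _ = _ := by
        rw [h, ← mul_assoc, hc, Complex.I_sq]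
        ring_nf

lemma stdGaussian_eq_withDensity :
    stdGaussian E = volume.withDensity fun u ↦ ENNReal.ofReal (stdGaussianPDFReal u) := by
  have : IsFiniteMeasure
      ((volume : Measure E).withDensity fun u ↦ ENNReal.ofReal (stdGaussianPDFReal u)) :=
    isFiniteMeasure_withDensity_ofReal integrable_stdGaussianPDFReal.2
  refine Measure.ext_of_charFun (funext fun t ↦ ?_)
  rw [charFun_stdGaussian, charFun_apply, integral_withDensity_eq_integral_toReal_smul
    (by exact continuous_stdGaussianPDFReal.measurable.ennreal_ofReal) (by simp),
    ← integral_stdGaussianPDFReal_smul_cexp]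
  simp only [ENNReal.toReal_ofReal (stdGaussianPDFReal_nonneg _)]

lemma integral_stdGaussian_eq_integral_smul {F : Type*} [NormedAddCommGroup F] [NormedSpace ℝ F]
    (f : E → F) : ∫ u, f u ∂(stdGaussian E) = ∫ u, stdGaussianPDFReal u • f u := by
  rw [stdGaussian_eq_withDensity, integral_withDensity_eq_integral_toReal_smul
    (by exact continuous_stdGaussianPDFReal.measurable.ennreal_ofReal) (by simp)]
  simp only [ENNReal.toReal_ofReal (stdGaussianPDFReal_nonneg _)]

lemma integrable_stdGaussian_iff_integrable_smul {F : Type*} [NormedAddCommGroup F]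
    [NormedSpace ℝ F] {f : E → F} :
    Integrable f (stdGaussian E) ↔ Integrable (fun u ↦ stdGaussianPDFReal u • f u) := by
  rw [stdGaussian_eq_withDensity, integrable_withDensity_iff_integrable_smul'
    continuous_stdGaussianPDFReal.measurable.ennreal_ofReal (by simp)]
  simp only [ENNReal.toReal_ofReal (stdGaussianPDFReal_nonneg _)]

lemma integral_inner_mul_stdGaussian {F F' : E → ℝ} {v : E}
    (hF : ∀ u, HasLineDerivAt ℝ F (F' u) u v) (hFi : Integrable F (stdGaussian E))
    (hF'i : Integrable F' (stdGaussian E))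
    (hvF : Integrable (fun u ↦ ⟪v, u⟫ * F u) (stdGaussian E)) :
    ∫ u, ⟪v, u⟫ * F u ∂(stdGaussian E) = ∫ u, F' u ∂(stdGaussian E) := by
  rw [integrable_stdGaussian_iff_integrable_smul] at hFi hF'i hvF
  have hpdf (u : E) :
      HasLineDerivAt ℝ stdGaussianPDFReal (-(stdGaussianPDFReal u * ⟪v, u⟫)) u v := by
    simpa [real_inner_comm] using (hasFDerivAt_stdGaussianPDFReal u).hasLineDerivAt v
  have hparts := integral_bilinear_hasLineDerivAt_right_eq_neg_left_of_integrable
    (μ := (volume : Measure E)) (B := ContinuousLinearMap.mul ℝ ℝ)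
    (by simpa [mul_assoc] using hvF.neg) (by simpa using hF'i) (by simpa using hFi)
    (fun u _ ↦ hpdf u) (fun u _ ↦ hF u)
  rw [integral_stdGaussian_eq_integral_smul, integral_stdGaussian_eq_integral_smul]
  simpa [integral_neg, mul_assoc] using hparts.symm

end SteinIdentity

section Moments

variable {E : Type*} [NormedAddCommGroup E] [InnerProductSpace ℝ E] [FiniteDimensional ℝ E]
  [MeasurableSpace E] [BorelSpace E]

lemma integrable_norm_pow_stdGaussian (k : ℕ) :
    Integrable (fun u ↦ ‖u‖ ^ k) (stdGaussian E) :=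
  (IsGaussian.memLp_id (stdGaussian E) k (by simp)).integrable_norm_pow'

lemma integrable_inner_pow_mul_norm_pow_stdGaussian (v : E) (i j : ℕ) :
    Integrable (fun u ↦ ⟪v, u⟫ ^ i * ‖u‖ ^ j) (stdGaussian E) := by
  refine ((integrable_norm_pow_stdGaussian (i + j)).const_mul (‖v‖ ^ i)).mono' (by fun_prop)
    (ae_of_all _ fun u ↦ ?_)
  calc ‖⟪v, u⟫ ^ i * ‖u‖ ^ j‖ = |⟪v, u⟫| ^ i * ‖u‖ ^ j := by simp
    _ ≤ (‖v‖ * ‖u‖) ^ i * ‖u‖ ^ j := by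
      gcongr
      exact abs_real_inner_le_norm v u
    _ = ‖v‖ ^ i * ‖u‖ ^ (i + j) := by ring

lemma memLp_inner_stdGaussian (v : E) : MemLp (fun u ↦ ⟪v, u⟫) 2 (stdGaussian E) :=
  IsGaussian.memLp_two_id.const_inner v

lemma integral_inner_mul_inner_stdGaussian (v w : E) :
    ∫ u, ⟪v, u⟫ * ⟪w, u⟫ ∂(stdGaussian E) = ⟪v, w⟫ := by
  have hstein := integral_inner_mul_stdGaussian (F := fun u ↦ ⟪w, u⟫) (F' := fun _ ↦ ⟪v, w⟫)
    (v := v) (fun u ↦ by simpa [real_inner_comm] using (innerSL ℝ w).hasFDerivAt.hasLineDerivAt v)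
    ((memLp_inner_stdGaussian w).integrable one_le_two) (integrable_const _)
    ((memLp_inner_stdGaussian v).integrable_mul (memLp_inner_stdGaussian w))
  simpa using hstein

lemma integral_inner_sq_mul_norm_pow_stdGaussian (v : E) (k : ℕ) :
    ∫ u, ⟪v, u⟫ ^ 2 * ‖u‖ ^ (2 * k) ∂(stdGaussian E)
      = ‖v‖ ^ 2 * ∫ u, ‖u‖ ^ (2 * k) ∂(stdGaussian E)
        + 2 * k * ∫ u, ⟪v, u⟫ ^ 2 * ‖u‖ ^ (2 * (k - 1)) ∂(stdGaussian E) := by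
  have hderiv (u : E) : HasLineDerivAt ℝ (fun u ↦ ⟪v, u⟫ * ‖u‖ ^ (2 * k))
      (‖v‖ ^ 2 * ‖u‖ ^ (2 * k) + 2 * k * (⟪v, u⟫ ^ 2 * ‖u‖ ^ (2 * (k - 1)))) u v := by
    have h := ((innerSL ℝ v).hasFDerivAt (x := u)).mul
      ((hasStrictFDerivAt_norm_sq u).hasFDerivAt.pow k)
    convert! h.hasLineDerivAt v using 1
    · ext w
      simp [pow_mul]
    · simp only [pow_mul, coe_innerSL_apply, nsmul_eq_mul, add_apply, smul_apply, real_inner_comm,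
        Nat.cast_ofNat, smul_eq_mul, real_inner_self_eq_norm_sq]
      ring
  have hnorm : Integrable (fun u : E ↦ ‖v‖ ^ 2 * ‖u‖ ^ (2 * k)) (stdGaussian E) :=
    (integrable_norm_pow_stdGaussian _).const_mul _
  have hinner : Integrable (fun u ↦ 2 * k * (⟪v, u⟫ ^ 2 * ‖u‖ ^ (2 * (k - 1)))) (stdGaussian E) :=
    (integrable_inner_pow_mul_norm_pow_stdGaussian v 2 _).const_mul _
  have hsq (u : E) : ⟪v, u⟫ ^ 2 * ‖u‖ ^ (2 * k) = ⟪v, u⟫ * (⟪v, u⟫ * ‖u‖ ^ (2 * k)) := by ring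
  rw [← integral_const_mul, ← integral_const_mul, ← integral_add hnorm hinner]
  simp_rw [hsq]
  refine integral_inner_mul_stdGaussian hderiv ?_ (hnorm.add hinner) ?_
  · simpa using integrable_inner_pow_mul_norm_pow_stdGaussian v 1 (2 * k)
  · simpa [hsq] using integrable_inner_pow_mul_norm_pow_stdGaussian v 2 (2 * k)

lemma sum_integral_inner_sq_mul_norm_pow_stdGaussian (j : ℕ) :
    ∑ i, ∫ u, ⟪stdOrthonormalBasis ℝ E i, u⟫ ^ 2 * ‖u‖ ^ j ∂(stdGaussian E)
      = ∫ u, ‖u‖ ^ (j + 2) ∂(stdGaussian E) := by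
  rw [← integral_finsetSum _ fun i _ ↦ integrable_inner_pow_mul_norm_pow_stdGaussian _ 2 j]
  simp_rw [← Finset.sum_mul, OrthonormalBasis.sum_sq_inner_right, ← pow_add, add_comm 2]

lemma integral_norm_pow_succ_stdGaussian (k : ℕ) :
    ∫ u, ‖u‖ ^ (2 * (k + 1)) ∂(stdGaussian E)
      = (finrank ℝ E + 2 * k) * ∫ u, ‖u‖ ^ (2 * k) ∂(stdGaussian E) := by
  calc ∫ u, ‖u‖ ^ (2 * (k + 1)) ∂(stdGaussian E)
      = ∑ i, ∫ u, ⟪stdOrthonormalBasis ℝ E i, u⟫ ^ 2 * ‖u‖ ^ (2 * k) ∂(stdGaussian E) := by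
        rw [sum_integral_inner_sq_mul_norm_pow_stdGaussian, mul_add_one]
    _ = finrank ℝ E * ∫ u, ‖u‖ ^ (2 * k) ∂(stdGaussian E)
          + 2 * k * ∫ u, ‖u‖ ^ (2 * (k - 1) + 2) ∂(stdGaussian E) := by
        rw [Finset.sum_congr rfl fun i _ ↦ integral_inner_sq_mul_norm_pow_stdGaussian _ k,
          Finset.sum_add_distrib, ← Finset.mul_sum, sum_integral_inner_sq_mul_norm_pow_stdGaussian]
        simp
    _ = (finrank ℝ E + 2 * k) * ∫ u, ‖u‖ ^ (2 * k) ∂(stdGaussian E) := by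
        rcases k with _ | k
        · simp
        · rw [add_tsub_cancel_right, ← mul_add_one]
          ring

lemma integral_norm_pow_two_stdGaussian :
    ∫ u, ‖u‖ ^ 2 ∂(stdGaussian E) = finrank ℝ E := by
  simpa using integral_norm_pow_succ_stdGaussian (E := E) 0

lemma integral_norm_pow_four_stdGaussian :
    ∫ u, ‖u‖ ^ 4 ∂(stdGaussian E) = finrank ℝ E * (finrank ℝ E + 2) := by
  rw [integral_norm_pow_succ_stdGaussian (E := E) 1, mul_one, integral_norm_pow_two_stdGaussian]
  push_cast
  ring

lemma integral_norm_pow_six_stdGaussian :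
    ∫ u, ‖u‖ ^ 6 ∂(stdGaussian E)
      = finrank ℝ E * (finrank ℝ E + 2) * (finrank ℝ E + 4) := by
  rw [integral_norm_pow_succ_stdGaussian (E := E) 2, integral_norm_pow_four_stdGaussian]
  push_cast
  ring

lemma integrable_even_sextic_norm_stdGaussian (a b c : ℝ) :
    Integrable (fun u : E ↦ a * ‖u‖ ^ 6 + b * ‖u‖ ^ 4 + c * ‖u‖ ^ 2) (stdGaussian E) :=
  (((integrable_norm_pow_stdGaussian 6).const_mul a).add
    ((integrable_norm_pow_stdGaussian 4).const_mul b)).add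
    ((integrable_norm_pow_stdGaussian 2).const_mul c)

lemma integral_even_sextic_norm_stdGaussian (a b c : ℝ) :
    ∫ u, (a * ‖u‖ ^ 6 + b * ‖u‖ ^ 4 + c * ‖u‖ ^ 2) ∂(stdGaussian E)
      = a * (finrank ℝ E * (finrank ℝ E + 2) * (finrank ℝ E + 4))
        + b * (finrank ℝ E * (finrank ℝ E + 2)) + c * finrank ℝ E := by
  have hsix := (integrable_norm_pow_stdGaussian (E := E) 6).const_mul a
  have hfour := (integrable_norm_pow_stdGaussian (E := E) 4).const_mul b
  rw [integral_add (by exact hsix.add hfour) ((integrable_norm_pow_stdGaussian 2).const_mul c),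
    integral_add hsix hfour, integral_const_mul, integral_const_mul, integral_const_mul,
    integral_norm_pow_six_stdGaussian, integral_norm_pow_four_stdGaussian,
    integral_norm_pow_two_stdGaussian]

lemma integral_inner_sq_mul_norm_sq_stdGaussian (v : E) :
    ∫ u, ⟪v, u⟫ ^ 2 * ‖u‖ ^ 2 ∂(stdGaussian E) = (finrank ℝ E + 2) * ‖v‖ ^ 2 := by
  have hcov : ∫ u, ⟪v, u⟫ ^ 2 ∂(stdGaussian E) = ‖v‖ ^ 2 := by
    simpa [sq] using integral_inner_mul_inner_stdGaussian v v
  have hrec := integral_inner_sq_mul_norm_pow_stdGaussian v 1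
  simp only [mul_one, tsub_self, mul_zero, pow_zero, Nat.cast_one, hcov,
    integral_norm_pow_two_stdGaussian] at hrec
  rw [hrec]
  ring

end Moments

section Bessel

variable {E : Type*} [NormedAddCommGroup E] [InnerProductSpace ℝ E] [FiniteDimensional ℝ E]
  [MeasurableSpace E] [BorelSpace E]

lemma integrable_smul_stdGaussian {h : E → ℝ} (hh : MemLp h 2 (stdGaussian E)) :
    Integrable (fun u ↦ h u • u) (stdGaussian E) :=
  memLp_one_iff_integrable.1 (IsGaussian.memLp_two_id.smul hh)

lemma integral_inner_smul_stdGaussian (v : E) :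
    ∫ u, ⟪v, u⟫ • u ∂(stdGaussian E) = v := by
  refine ext_inner_left ℝ fun w ↦ ?_
  rw [← integral_inner
    (integrable_smul_stdGaussian (memLp_inner_stdGaussian v)) w]
  simp_rw [inner_smul_right]
  rw [integral_inner_mul_inner_stdGaussian, real_inner_comm]

lemma norm_integral_smul_stdGaussian_sq_le {h : E → ℝ} (hh : MemLp h 2 (stdGaussian E)) :
    ‖∫ u, h u • u ∂(stdGaussian E)‖ ^ 2 ≤ ∫ u, h u ^ 2 ∂(stdGaussian E) := by
  set w := ∫ u, h u • u ∂(stdGaussian E)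
  have hw : MemLp (fun u ↦ ⟪w, u⟫) 2 (stdGaussian E) := memLp_inner_stdGaussian w
  have hhw : Integrable (fun u ↦ 2 * (h u * ⟪w, u⟫)) (stdGaussian E) :=
    (hh.integrable_mul hw).const_mul 2
  have hcross : ∫ u, h u * ⟪w, u⟫ ∂(stdGaussian E) = ‖w‖ ^ 2 := by
    simp_rw [← inner_smul_right]
    rw [integral_inner (integrable_smul_stdGaussian hh), real_inner_self_eq_norm_sq]
  have hsq : ∫ u, ⟪w, u⟫ ^ 2 ∂(stdGaussian E) = ‖w‖ ^ 2 := by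
    simpa [sq] using integral_inner_mul_inner_stdGaussian w w
  have hexpand : ∫ u, (h u - ⟪w, u⟫) ^ 2 ∂(stdGaussian E)
      = ∫ u, h u ^ 2 ∂(stdGaussian E) - ‖w‖ ^ 2 := by
    simp_rw [sub_sq, mul_assoc]
    rw [integral_add (by exact hh.integrable_sq.sub hhw) hw.integrable_sq,
      integral_sub hh.integrable_sq hhw, integral_const_mul, hcross, hsq]
    ring
  have hnonneg : 0 ≤ ∫ u, (h u - ⟪w, u⟫) ^ 2 ∂(stdGaussian E) :=
    integral_nonneg fun u ↦ sq_nonneg _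
  linarith

end Bessel

section Taylor

variable {E : Type*} [NormedAddCommGroup E] [InnerProductSpace ℝ E] [CompleteSpace E]

lemma abs_sub_sub_inner_gradient_le {φ : E → ℝ} (hφ : Differentiable ℝ φ) {L : ℝ≥0}
    (hL : LipschitzWith L (gradient φ)) (x h : E) :
    |φ (x + h) - φ x - ⟪gradient φ x, h⟫| ≤ L / 2 * ‖h‖ ^ 2 := by
  have hderiv (t : ℝ) : HasDerivAt (fun t : ℝ ↦ φ (x + t • h) - φ x - t * ⟪gradient φ x, h⟫)
      ⟪gradient φ (x + t • h) - gradient φ x, h⟫ t := by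
    have hline : HasDerivAt (fun t : ℝ ↦ x + t • h) h t := by
      simpa using ((hasDerivAt_id t).smul_const h).const_add x
    have hcomp := (hφ (x + t • h)).hasGradientAt.hasFDerivAt.comp_hasDerivAt t hline
    convert! (hcomp.sub_const (φ x)).sub ((hasDerivAt_id t).mul_const ⟪gradient φ x, h⟫) using 1
    simp [inner_sub_left]
  have hbound (t : ℝ) : HasDerivAt (fun t : ℝ ↦ L / 2 * ‖h‖ ^ 2 * t ^ 2) (L * ‖h‖ ^ 2 * t) t := by
    convert! (hasDerivAt_pow 2 t).const_mul (L / 2 * ‖h‖ ^ 2) using 1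
    push_cast
    ring
  have hremainder := image_norm_le_of_norm_deriv_right_le_deriv_boundary (a := 0) (b := 1)
    (fun t _ ↦ (hderiv t).continuousAt.continuousWithinAt)
    (fun t _ ↦ (hderiv t).hasDerivWithinAt) (by simp) hbound (fun t ht ↦ ?_)
    (Set.right_mem_Icc.2 zero_le_one)
  · simpa using hremainder
  · have hgrad := hL.norm_sub_le (x + t • h) x
    rw [add_sub_cancel_left, norm_smul, norm_of_nonneg ht.1] at hgrad
    calc ‖⟪gradient φ (x + t • h) - gradient φ x, h⟫‖
        ≤ ‖gradient φ (x + t • h) - gradient φ x‖ * ‖h‖ := norm_inner_le_norm _ _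
      _ ≤ L * (t * ‖h‖) * ‖h‖ := by gcongr
      _ = L * ‖h‖ ^ 2 * t := by ring

end Taylor

section SampleMean

variable {E κ Ω : Type*} [NormedAddCommGroup E] [InnerProductSpace ℝ E] [MeasurableSpace Ω]
  {P : Measure Ω}

lemma integrable_inner_of_memLp_two {X Y : Ω → E} (hX : MemLp X 2 P) (hY : MemLp Y 2 P) :
    Integrable (fun ω ↦ ⟪X ω, Y ω⟫) P :=
  (hX.norm.integrable_mul hY.norm).mono' (hX.1.inner hY.1)
    (ae_of_all _ fun _ ↦ norm_inner_le_norm _ _)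

variable [CompleteSpace E]

lemma integral_norm_sub_integral_sq_le [IsProbabilityMeasure P] {X : Ω → E} (hX : MemLp X 2 P) :
    ∫ ω, ‖X ω - ∫ ω, X ω ∂P‖ ^ 2 ∂P ≤ ∫ ω, ‖X ω‖ ^ 2 ∂P := by
  set m := ∫ ω, X ω ∂P
  have hint : Integrable X P := hX.integrable one_le_two
  have hsq : Integrable (fun ω ↦ ‖X ω‖ ^ 2) P := (memLp_two_iff_integrable_sq_norm hX.1).1 hX
  have hcross : Integrable (fun ω ↦ 2 * ⟪m, X ω⟫) P := (hint.const_inner m).const_mul 2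
  calc ∫ ω, ‖X ω - m‖ ^ 2 ∂P = ∫ ω, (‖X ω‖ ^ 2 - 2 * ⟪m, X ω⟫ + ‖m‖ ^ 2) ∂P := by
        simp_rw [norm_sub_sq_real, real_inner_comm]
    _ = ∫ ω, ‖X ω‖ ^ 2 ∂P - ‖m‖ ^ 2 := by
        rw [integral_add (by exact hsq.sub hcross) (integrable_const _), integral_sub hsq hcross,
          integral_const_mul, integral_inner hint, real_inner_self_eq_norm_sq, integral_const,
          probReal_univ, one_smul]
        ring
    _ ≤ ∫ ω, ‖X ω‖ ^ 2 ∂P := sub_le_self _ (sq_nonneg _)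

variable [MeasurableSpace E] [BorelSpace E] [Fintype κ]

lemma integral_norm_sum_sq_eq_sum [IsFiniteMeasure P] {Y : κ → Ω → E} (hY : ∀ i, MemLp (Y i) 2 P)
    (hindep : Pairwise fun i j ↦ IndepFun (Y i) (Y j) P) (hcentered : ∀ i, ∫ ω, Y i ω ∂P = 0) :
    ∫ ω, ‖∑ i, Y i ω‖ ^ 2 ∂P = ∑ i, ∫ ω, ‖Y i ω‖ ^ 2 ∂P := by
  have horth (i j : κ) (hij : i ≠ j) : ∫ ω, ⟪Y i ω, Y j ω⟫ ∂P = 0 := by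
    calc ∫ ω, ⟪Y i ω, Y j ω⟫ ∂P = ⟪∫ ω, Y i ω ∂P, ∫ ω, Y j ω ∂P⟫ :=
          (hindep hij).integral_bilin ((hY i).integrable one_le_two)
            ((hY j).integrable one_le_two) (innerSL ℝ)
      _ = 0 := by rw [hcentered, inner_zero_left]
  calc ∫ ω, ‖∑ i, Y i ω‖ ^ 2 ∂P = ∫ ω, ∑ i, ∑ j, ⟪Y i ω, Y j ω⟫ ∂P := by
        simp_rw [← real_inner_self_eq_norm_sq, sum_inner, inner_sum]
    _ = ∑ i, ∑ j, ∫ ω, ⟪Y i ω, Y j ω⟫ ∂P := by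
        rw [integral_finsetSum _ fun i _ ↦ integrable_finsetSum _ fun j _ ↦
          integrable_inner_of_memLp_two (hY i) (hY j)]
        exact Finset.sum_congr rfl fun i _ ↦
          integral_finsetSum _ fun j _ ↦ integrable_inner_of_memLp_two (hY i) (hY j)
    _ = ∑ i, ∫ ω, ‖Y i ω‖ ^ 2 ∂P := by
        refine Finset.sum_congr rfl fun i _ ↦ ?_
        rw [Finset.sum_eq_single i (fun j _ hji ↦ horth i j hji.symm) (by simp)]
        simp_rw [real_inner_self_eq_norm_sq]

variable [IsProbabilityMeasure P] [Nonempty κ] {X : κ → Ω → E} {m : E} {V : ℝ}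

lemma integral_norm_mean_sub_sq_le (hX : ∀ i, MemLp (X i) 2 P) (hindep : iIndepFun X P)
    (hm : ∀ i, ∫ ω, X i ω ∂P = m) (hV : ∀ i, ∫ ω, ‖X i ω‖ ^ 2 ∂P ≤ V) :
    ∫ ω, ‖(1 / (Fintype.card κ : ℝ)) • ∑ i, X i ω - m‖ ^ 2 ∂P ≤ V / Fintype.card κ := by
  have hcard : (0 : ℝ) < Fintype.card κ := by exact_mod_cast Fintype.card_pos
  have hmean (ω : Ω) : (1 / (Fintype.card κ : ℝ)) • ∑ i, X i ω - m
      = (1 / (Fintype.card κ : ℝ)) • ∑ i, (X i ω - m) := by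
    rw [Finset.sum_sub_distrib, smul_sub, Finset.sum_const, Finset.card_univ,
      ← Nat.cast_smul_eq_nsmul ℝ, smul_smul, one_div_mul_cancel hcard.ne', one_smul]
  have hcentered (i : κ) : ∫ ω, (X i ω - m) ∂P = 0 := by
    rw [integral_sub ((hX i).integrable one_le_two) (integrable_const _), hm]
    simp
  have hdev (i : κ) : ∫ ω, ‖X i ω - m‖ ^ 2 ∂P ≤ V := by
    simpa only [hm] using (integral_norm_sub_integral_sq_le (hX i)).trans (hV i)
  calc ∫ ω, ‖(1 / (Fintype.card κ : ℝ)) • ∑ i, X i ω - m‖ ^ 2 ∂P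
      = (1 / (Fintype.card κ : ℝ)) ^ 2 * ∫ ω, ‖∑ i, (X i ω - m)‖ ^ 2 ∂P := by
        simp_rw [hmean, norm_smul, mul_pow, norm_eq_abs, sq_abs, integral_const_mul]
    _ = (1 / (Fintype.card κ : ℝ)) ^ 2 * ∑ i, ∫ ω, ‖X i ω - m‖ ^ 2 ∂P := by
        rw [integral_norm_sum_sq_eq_sum (Y := fun i ω ↦ X i ω - m)
          (fun i ↦ (hX i).sub (memLp_const m))
          (fun i j hij ↦ (hindep.indepFun hij).comp (φ := (· - m)) (ψ := (· - m))
            (by fun_prop) (by fun_prop)) hcentered]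
    _ ≤ (1 / (Fintype.card κ : ℝ)) ^ 2 * ∑ _i : κ, V := by gcongr with i; exact hdev i
    _ = V / Fintype.card κ := by
        rw [Finset.sum_const, Finset.card_univ, nsmul_eq_mul]
        field_simp

lemma sq_mul_measureReal_norm_mean_sub_ge_le (hX : ∀ i, MemLp (X i) 2 P) (hindep : iIndepFun X P)
    (hm : ∀ i, ∫ ω, X i ω ∂P = m) (hV : ∀ i, ∫ ω, ‖X i ω‖ ^ 2 ∂P ≤ V) {ρ : ℝ} (hρ : 0 ≤ ρ) :
    ρ ^ 2 * P.real {ω | ρ ≤ ‖(1 / (Fintype.card κ : ℝ)) • ∑ i, X i ω - m‖}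
      ≤ V / Fintype.card κ := by
  have hmem : MemLp (fun ω ↦ (1 / (Fintype.card κ : ℝ)) • ∑ i, X i ω - m) 2 P :=
    ((memLp_finsetSum _ fun i _ ↦ hX i).const_smul _).sub (memLp_const m)
  have hmarkov := mul_meas_ge_le_integral_of_nonneg (ae_of_all P fun ω ↦ sq_nonneg _)
    ((memLp_two_iff_integrable_sq_norm hmem.1).1 hmem) (ρ ^ 2)
  simp_rw [pow_le_pow_iff_left₀ hρ (norm_nonneg _) two_ne_zero] at hmarkov
  exact hmarkov.trans (integral_norm_mean_sub_sq_le hX hindep hm hV)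

lemma one_sub_le_measureReal_norm_mean_sub_le (hX : ∀ i, MemLp (X i) 2 P) (hindep : iIndepFun X P)
    (hm : ∀ i, ∫ ω, X i ω ∂P = m) (hV : ∀ i, ∫ ω, ‖X i ω‖ ^ 2 ∂P ≤ V) {ρ δ : ℝ} (hρ : 0 < ρ)
    (hVδ : V ≤ δ * Fintype.card κ * ρ ^ 2) {y : E} {r : ℝ} (hr : ρ + ‖m - y‖ ≤ r) :
    1 - δ ≤ P.real {ω | ‖(1 / (Fintype.card κ : ℝ)) • ∑ i, X i ω - y‖ ≤ r} := by
  set bad := {ω | ρ ≤ ‖(1 / (Fintype.card κ : ℝ)) • ∑ i, X i ω - m‖}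
  have hcard : (0 : ℝ) < Fintype.card κ := by exact_mod_cast Fintype.card_pos
  have hbad : P.real bad ≤ δ := by
    refine le_of_mul_le_mul_left ?_ (pow_pos hρ 2)
    refine (sq_mul_measureReal_norm_mean_sub_ge_le hX hindep hm hV hρ.le).trans ?_
    rw [div_le_iff₀ hcard]
    linarith
  have hcover : Set.univ ⊆ {ω | ‖(1 / (Fintype.card κ : ℝ)) • ∑ i, X i ω - y‖ ≤ r} ∪ bad := by
    intro ω _
    by_cases hω : ω ∈ bad
    · exact Or.inr hω
    · have htriangle := norm_sub_le_norm_sub_add_norm_sub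
        ((1 / (Fintype.card κ : ℝ)) • ∑ i, X i ω) m y
      have hdev : ‖(1 / (Fintype.card κ : ℝ)) • ∑ i, X i ω - m‖ < ρ := not_le.1 hω
      exact Or.inl (by linarith : _ ≤ r)
  have hone := (measureReal_mono hcover).trans (measureReal_union_le (μ := P) _ _)
  rw [probReal_univ] at hone
  linarith

lemma one_sub_le_measureReal_norm_sampleMean_sub_le {F : Type*} [MeasurableSpace F]
    {ν : Measure F} {u : κ → Ω → F} (hindep : iIndepFun u P) (hlaw : ∀ i, HasLaw (u i) ν P)
    {Y : F → E} (hYm : Measurable Y) (hY : MemLp Y 2 ν) {ρ δ : ℝ} (hρ : 0 < ρ)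
    (hVδ : ∫ v, ‖Y v‖ ^ 2 ∂ν ≤ δ * Fintype.card κ * ρ ^ 2) {y : E} {r : ℝ}
    (hr : ρ + ‖∫ v, Y v ∂ν - y‖ ≤ r) :
    1 - δ ≤ P.real {ω | ‖(1 / (Fintype.card κ : ℝ)) • ∑ i, Y (u i ω) - y‖ ≤ r} := by
  refine one_sub_le_measureReal_norm_mean_sub_le (X := fun i ω ↦ Y (u i ω)) (fun i ↦ ?_)
    (hindep.comp (fun _ ↦ Y) fun _ ↦ hYm) (fun i ↦ (hlaw i).integral_comp hY.1)
    (fun i ↦ ((hlaw i).integral_comp (hY.1.norm.pow 2)).le) hρ hVδ hr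
  rw [← (hlaw i).map_eq] at hY
  exact hY.comp_of_map (hlaw i).aemeasurable

end SampleMean

section DifferenceQuotient

variable {E : Type*} [NormedAddCommGroup E] [InnerProductSpace ℝ E]

/-- The difference quotient `(f (x + σ u) - f x) / σ`, the weight of the sampling direction `u` in
the Gaussian smoothed gradient of `f` at `x`. -/
noncomputable def differenceQuotient (f : E → ℝ) (σ : ℝ) (x u : E) : ℝ :=
  (f (x + σ • u) - f x) / σ

lemma measurable_differenceQuotient [MeasurableSpace E] [BorelSpace E] {f : E → ℝ}
    (hf : Measurable f) (σ : ℝ) (x : E) : Measurable (differenceQuotient f σ x) := by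
  unfold differenceQuotient
  fun_prop

variable [CompleteSpace E] {f φ : E → ℝ} {L : ℝ≥0} {ε σ : ℝ}

-- The noise at the base point only shifts the quotient by a constant, and `c • u` has mean zero: it
-- need not be counted in the bias.
lemma abs_differenceQuotient_sub_inner_add_le (hφ : Differentiable ℝ φ)
    (hLip : LipschitzWith L (gradient φ)) (hnoise : ∀ y, |f y - φ y| ≤ ε) (hσ : 0 < σ)
    (hε : ε ≤ L * σ ^ 2) (x u : E) :
    |differenceQuotient f σ x u - ⟪gradient φ x, u⟫ + (f x - φ x) / σ|
      ≤ L * σ * (‖u‖ ^ 2 / 2 + 1) := by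
  have htaylor := abs_sub_sub_inner_gradient_le hφ hLip x (σ • u)
  rw [inner_smul_right, norm_smul, norm_of_nonneg hσ.le] at htaylor
  have hsplit : differenceQuotient f σ x u - ⟪gradient φ x, u⟫ + (f x - φ x) / σ
      = ((f (x + σ • u) - φ (x + σ • u))
        + (φ (x + σ • u) - φ x - σ * ⟪gradient φ x, u⟫)) / σ := by
    unfold differenceQuotient
    field_simp
    ring
  rw [hsplit, abs_div, abs_of_pos hσ, div_le_iff₀ hσ]
  calc |f (x + σ • u) - φ (x + σ • u) + (φ (x + σ • u) - φ x - σ * ⟪gradient φ x, u⟫)|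
      ≤ |f (x + σ • u) - φ (x + σ • u)| + |φ (x + σ • u) - φ x - σ * ⟪gradient φ x, u⟫| :=
        abs_add_le _ _
    _ ≤ L * σ ^ 2 + L / 2 * (σ * ‖u‖) ^ 2 := add_le_add ((hnoise _).trans hε) htaylor
    _ = L * σ * (‖u‖ ^ 2 / 2 + 1) * σ := by ring

lemma abs_differenceQuotient_sub_inner_le (hφ : Differentiable ℝ φ)
    (hLip : LipschitzWith L (gradient φ)) (hnoise : ∀ y, |f y - φ y| ≤ ε) (hσ : 0 < σ)
    (hε : ε ≤ L * σ ^ 2) (x u : E) :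
    |differenceQuotient f σ x u - ⟪gradient φ x, u⟫| ≤ L * σ * (‖u‖ ^ 2 / 2 + 2) := by
  have hshift : |(f x - φ x) / σ| ≤ L * σ := by
    rw [abs_div, abs_of_pos hσ, div_le_iff₀ hσ]
    linarith [hnoise x]
  calc |differenceQuotient f σ x u - ⟪gradient φ x, u⟫|
      = |(differenceQuotient f σ x u - ⟪gradient φ x, u⟫ + (f x - φ x) / σ)
          - (f x - φ x) / σ| := by rw [add_sub_cancel_right]
    _ ≤ |differenceQuotient f σ x u - ⟪gradient φ x, u⟫ + (f x - φ x) / σ|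
          + |(f x - φ x) / σ| := abs_sub _ _
    _ ≤ L * σ * (‖u‖ ^ 2 / 2 + 1) + L * σ :=
        add_le_add (abs_differenceQuotient_sub_inner_add_le hφ hLip hnoise hσ hε x u) hshift
    _ = L * σ * (‖u‖ ^ 2 / 2 + 2) := by ring

end DifferenceQuotient

section AlmostLinearWeight

variable {E : Type*} [NormedAddCommGroup E] [InnerProductSpace ℝ E] {q r : E → ℝ} {v : E}
  {c s : ℝ}

lemma norm_smul_sq_le_of_abs_sub_inner_le {u : E}
    (hqs : |q u - ⟪v, u⟫| ≤ s * (‖u‖ ^ 2 / 2 + 2)) :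
    ‖q u • u‖ ^ 2 ≤ 3 / 2 * (⟪v, u⟫ ^ 2 * ‖u‖ ^ 2)
      + 3 * s ^ 2 * (1 / 4 * ‖u‖ ^ 6 + 2 * ‖u‖ ^ 4 + 4 * ‖u‖ ^ 2) := by
  have hdev : (q u - ⟪v, u⟫) ^ 2 ≤ (s * (‖u‖ ^ 2 / 2 + 2)) ^ 2 :=
    sq_le_sq' (abs_le.1 hqs).1 (abs_le.1 hqs).2
  have hyoung : q u ^ 2 ≤ 3 / 2 * ⟪v, u⟫ ^ 2 + 3 * (q u - ⟪v, u⟫) ^ 2 := by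
    nlinarith [sq_nonneg (2 * q u - 3 * ⟪v, u⟫)]
  calc ‖q u • u‖ ^ 2 = q u ^ 2 * ‖u‖ ^ 2 := by rw [norm_smul, mul_pow, norm_eq_abs, sq_abs]
    _ ≤ (3 / 2 * ⟪v, u⟫ ^ 2 + 3 * (s * (‖u‖ ^ 2 / 2 + 2)) ^ 2) * ‖u‖ ^ 2 := by
        gcongr
        linarith
    _ = 3 / 2 * (⟪v, u⟫ ^ 2 * ‖u‖ ^ 2)
          + 3 * s ^ 2 * (1 / 4 * ‖u‖ ^ 6 + 2 * ‖u‖ ^ 4 + 4 * ‖u‖ ^ 2) := by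
        ring

variable [FiniteDimensional ℝ E] [MeasurableSpace E] [BorelSpace E]

lemma memLp_two_of_abs_le_norm_sq (hr : Measurable r) (hrs : ∀ u, |r u| ≤ s * (‖u‖ ^ 2 / 2 + 1)) :
    MemLp r 2 (stdGaussian E) := by
  have hnormSq : MemLp (fun u ↦ ‖u‖ ^ 2) 2 (stdGaussian E) := by
    rw [memLp_two_iff_integrable_sq (by fun_prop)]
    simpa only [← pow_mul] using integrable_norm_pow_stdGaussian (E := E) (2 * 2)
  have hbound : MemLp (fun u ↦ s * (‖u‖ ^ 2 / 2 + 1)) 2 (stdGaussian E) := by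
    simpa only [div_eq_inv_mul, Pi.add_def] using
      ((hnormSq.const_mul 2⁻¹).add (memLp_const 1)).const_mul s
  exact hbound.mono' hr.aestronglyMeasurable (ae_of_all _ hrs)

lemma integral_sq_le_of_abs_le_norm_sq (hr : Measurable r)
    (hrs : ∀ u, |r u| ≤ s * (‖u‖ ^ 2 / 2 + 1)) :
    ∫ u, r u ^ 2 ∂(stdGaussian E) ≤ (s * ((finrank ℝ E + 3) / 2)) ^ 2 := by
  have hfour : Integrable (fun u ↦ 1 / 4 * ‖u‖ ^ 4) (stdGaussian E) :=
    (integrable_norm_pow_stdGaussian 4).const_mul _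
  have htwo := integrable_norm_pow_stdGaussian (E := E) 2
  calc ∫ u, r u ^ 2 ∂(stdGaussian E)
      ≤ ∫ u, s ^ 2 * (1 / 4 * ‖u‖ ^ 4 + ‖u‖ ^ 2 + 1) ∂(stdGaussian E) := by
        refine integral_mono (memLp_two_of_abs_le_norm_sq hr hrs).integrable_sq
          (((hfour.add htwo).add (integrable_const 1)).const_mul _) fun u ↦ ?_
        calc r u ^ 2 ≤ (s * (‖u‖ ^ 2 / 2 + 1)) ^ 2 :=
              sq_le_sq' (abs_le.1 (hrs u)).1 (abs_le.1 (hrs u)).2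
          _ = s ^ 2 * (1 / 4 * ‖u‖ ^ 4 + ‖u‖ ^ 2 + 1) := by ring
    _ = s ^ 2 * (1 / 4 * (finrank ℝ E * (finrank ℝ E + 2)) + finrank ℝ E + 1) := by
        rw [integral_const_mul, integral_add (by exact hfour.add htwo) (integrable_const 1),
          integral_add hfour htwo, integral_const_mul, integral_norm_pow_four_stdGaussian,
          integral_norm_pow_two_stdGaussian, integral_const, probReal_univ, one_smul]
    _ ≤ s ^ 2 * ((finrank ℝ E + 3) / 2) ^ 2 := by
        gcongr
        linarith
    _ = (s * ((finrank ℝ E + 3) / 2)) ^ 2 := by ring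

lemma norm_integral_smul_sub_le (hs : 0 ≤ s) (hq : Measurable q)
    (hqs : ∀ u, |q u - ⟪v, u⟫ + c| ≤ s * (‖u‖ ^ 2 / 2 + 1)) :
    ‖∫ u, q u • u ∂(stdGaussian E) - v‖ ≤ s * ((finrank ℝ E + 3) / 2) := by
  have hr : Measurable fun u ↦ q u - ⟪v, u⟫ + c := by fun_prop
  have hrL2 := memLp_two_of_abs_le_norm_sq hr hqs
  have hmean : ∫ u, q u • u ∂(stdGaussian E) - v
      = ∫ u, (q u - ⟪v, u⟫ + c) • u ∂(stdGaussian E) := by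
    have hinner := integrable_smul_stdGaussian (memLp_inner_stdGaussian v)
    have hconst : Integrable (fun u ↦ c • u) (stdGaussian E) := IsGaussian.integrable_id.smul c
    have hdecomp (u : E) : q u • u = (q u - ⟪v, u⟫ + c) • u + ⟪v, u⟫ • u - c • u := by module
    simp_rw [hdecomp]
    rw [integral_sub (by exact (integrable_smul_stdGaussian hrL2).add hinner) hconst,
      integral_add (integrable_smul_stdGaussian hrL2) hinner, integral_inner_smul_stdGaussian,
      integral_smul, integral_id_stdGaussian, smul_zero, sub_zero, add_sub_cancel_right]
  rw [hmean]
  exact le_of_sq_le_sq ((norm_integral_smul_stdGaussian_sq_le hrL2).trans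
    (integral_sq_le_of_abs_le_norm_sq hr hqs)) (by positivity)

lemma memLp_smul_of_abs_sub_inner_le (hq : Measurable q)
    (hqs : ∀ u, |q u - ⟪v, u⟫| ≤ s * (‖u‖ ^ 2 / 2 + 2)) :
    MemLp (fun u ↦ q u • u) 2 (stdGaussian E) := by
  rw [memLp_two_iff_integrable_sq_norm (by fun_prop)]
  refine (((integrable_inner_pow_mul_norm_pow_stdGaussian v 2 2).const_mul (3 / 2)).add
    ((integrable_even_sextic_norm_stdGaussian (1 / 4) 2 4).const_mul (3 * s ^ 2))).mono'
    (by fun_prop) (ae_of_all _ fun u ↦ ?_)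
  rw [norm_of_nonneg (by positivity)]
  exact norm_smul_sq_le_of_abs_sub_inner_le (hqs u)

lemma integral_norm_smul_sq_le (hq : Measurable q)
    (hqs : ∀ u, |q u - ⟪v, u⟫| ≤ s * (‖u‖ ^ 2 / 2 + 2)) :
    ∫ u, ‖q u • u‖ ^ 2 ∂(stdGaussian E) ≤ 3 / 2 * ((finrank ℝ E + 2) * ‖v‖ ^ 2)
      + 3 * s ^ 2 * (finrank ℝ E * (finrank ℝ E + 4) * (finrank ℝ E + 10) / 4) := by
  have hsignal : Integrable (fun u ↦ 3 / 2 * (⟪v, u⟫ ^ 2 * ‖u‖ ^ 2)) (stdGaussian E) :=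
    (integrable_inner_pow_mul_norm_pow_stdGaussian v 2 2).const_mul _
  have herror : Integrable
      (fun u ↦ 3 * s ^ 2 * (1 / 4 * ‖u‖ ^ 6 + 2 * ‖u‖ ^ 4 + 4 * ‖u‖ ^ 2)) (stdGaussian E) :=
    (integrable_even_sextic_norm_stdGaussian _ _ _).const_mul _
  have hL2 := memLp_smul_of_abs_sub_inner_le hq hqs
  calc ∫ u, ‖q u • u‖ ^ 2 ∂(stdGaussian E)
      ≤ ∫ u, (3 / 2 * (⟪v, u⟫ ^ 2 * ‖u‖ ^ 2)
          + 3 * s ^ 2 * (1 / 4 * ‖u‖ ^ 6 + 2 * ‖u‖ ^ 4 + 4 * ‖u‖ ^ 2)) ∂(stdGaussian E) :=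
        integral_mono ((memLp_two_iff_integrable_sq_norm hL2.1).1 hL2) (hsignal.add herror)
          fun u ↦ norm_smul_sq_le_of_abs_sub_inner_le (hqs u)
    _ = _ := by
        rw [integral_add hsignal herror, integral_const_mul, integral_const_mul,
          integral_inner_sq_mul_norm_sq_stdGaussian, integral_even_sextic_norm_stdGaussian]
        ring

end AlmostLinearWeight

section Estimator

variable {E : Type*} [NormedAddCommGroup E] [InnerProductSpace ℝ E] [FiniteDimensional ℝ E]
  [MeasurableSpace E] [BorelSpace E] {f φ : E → ℝ} {L : ℝ≥0} {ε σ : ℝ}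

lemma norm_integral_differenceQuotient_smul_sub_gradient_le (hφ : Differentiable ℝ φ)
    (hLip : LipschitzWith L (gradient φ)) (hf : Measurable f) (hnoise : ∀ y, |f y - φ y| ≤ ε)
    (hσ : 0 < σ) (hε : ε ≤ L * σ ^ 2) (x : E) :
    ‖∫ u, differenceQuotient f σ x u • u ∂(stdGaussian E) - gradient φ x‖
      ≤ L * σ * ((finrank ℝ E + 3) / 2) :=
  norm_integral_smul_sub_le (by positivity) (measurable_differenceQuotient hf σ x)
    (abs_differenceQuotient_sub_inner_add_le hφ hLip hnoise hσ hε x)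

lemma memLp_differenceQuotient_smul (hφ : Differentiable ℝ φ)
    (hLip : LipschitzWith L (gradient φ)) (hf : Measurable f) (hnoise : ∀ y, |f y - φ y| ≤ ε)
    (hσ : 0 < σ) (hε : ε ≤ L * σ ^ 2) (x : E) :
    MemLp (fun u ↦ differenceQuotient f σ x u • u) 2 (stdGaussian E) :=
  memLp_smul_of_abs_sub_inner_le (measurable_differenceQuotient hf σ x)
    (abs_differenceQuotient_sub_inner_le hφ hLip hnoise hσ hε x)

lemma integral_norm_differenceQuotient_smul_sq_le (hφ : Differentiable ℝ φ)
    (hLip : LipschitzWith L (gradient φ)) (hf : Measurable f) (hnoise : ∀ y, |f y - φ y| ≤ ε)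
    (hσ : 0 < σ) (hε : ε ≤ L * σ ^ 2) (x : E) :
    ∫ u, ‖differenceQuotient f σ x u • u‖ ^ 2 ∂(stdGaussian E)
      ≤ 3 / 2 * ((finrank ℝ E + 2) * ‖gradient φ x‖ ^ 2)
        + 3 * (L * σ) ^ 2 * (finrank ℝ E * (finrank ℝ E + 4) * (finrank ℝ E + 10) / 4) :=
  integral_norm_smul_sq_le (measurable_differenceQuotient hf σ x)
    (abs_differenceQuotient_sub_inner_le hφ hLip hnoise hσ hε x)

end Estimator

section NumericalBounds

lemma le_mul_of_sample_size {d N θ δ : ℝ} (hd : 1 < d) (hθ : 0 < θ) (hδ : 0 < δ)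
    (hN : 3 * d / (δ * θ ^ 2) * (d / (√d - 1) ^ 2) + (d + 4) / (16 * δ) + 1 / δ ≤ N) :
    3 * (d + 2) + (d + 20) / 16 * θ ^ 2 ≤ δ * N * θ ^ 2 := by
  have hsqrt : 1 < √d := by rwa [lt_sqrt zero_le_one, one_pow]
  have hd_sq : √d ^ 2 = d := sq_sqrt (by linarith)
  have hdim : d + 2 ≤ d * (d / (√d - 1) ^ 2) := by
    rw [← mul_div_assoc, le_div_iff₀ (by nlinarith)]
    nlinarith [mul_nonneg (sqrt_nonneg d) (sq_nonneg (√d - 1))]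
  calc 3 * (d + 2) + (d + 20) / 16 * θ ^ 2
      ≤ 3 * (d * (d / (√d - 1) ^ 2)) + (d + 20) / 16 * θ ^ 2 := by gcongr
    _ = δ * (3 * d / (δ * θ ^ 2) * (d / (√d - 1) ^ 2) + (d + 4) / (16 * δ) + 1 / δ) * θ ^ 2 := by
        have : √d - 1 ≠ 0 := by linarith
        field_simp
        ring
    _ ≤ δ * N * θ ^ 2 := by gcongr

lemma bias_bound_le {d θ s G : ℝ} (hd : 2 ≤ d) (hs : 0 ≤ s) (hsG : 6 * d * s ≤ θ * G) :
    s * ((d + 3) / 2) ≤ 5 / 24 * (θ * G) := by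
  calc s * ((d + 3) / 2) ≤ s * (5 / 4 * d) := by gcongr; linarith
    _ ≤ 5 / 24 * (θ * G) := by linarith

lemma second_moment_bound_le {d N θ δ s G : ℝ} (hd : 2 ≤ d) (hs : 0 ≤ s)
    (hsG : 6 * d * s ≤ θ * G)
    (hN : 3 * (d + 2) + (d + 20) / 16 * θ ^ 2 ≤ δ * N * θ ^ 2) :
    3 / 2 * ((d + 2) * G ^ 2) + 3 * s ^ 2 * (d * (d + 4) * (d + 10) / 4)
      ≤ δ * N * (19 / 24 * (θ * G)) ^ 2 := by
  have hs_sq : (6 * d * s) ^ 2 ≤ (θ * G) ^ 2 := by gcongr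
  have hdim : (d + 4) * (d + 10) ≤ d * (d + 34) := by linarith
  have herror : 3 * s ^ 2 * (d * (d + 4) * (d + 10) / 4) ≤ (d + 34) / 48 * (θ * G) ^ 2 := by
    calc 3 * s ^ 2 * (d * (d + 4) * (d + 10) / 4)
        = 3 / 4 * s ^ 2 * d * ((d + 4) * (d + 10)) := by ring
      _ ≤ 3 / 4 * s ^ 2 * d * (d * (d + 34)) := by gcongr
      _ = (d + 34) / 48 * (6 * d * s) ^ 2 := by ring
      _ ≤ (d + 34) / 48 * (θ * G) ^ 2 := by gcongr
  calc 3 / 2 * ((d + 2) * G ^ 2) + 3 * s ^ 2 * (d * (d + 4) * (d + 10) / 4)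
      ≤ 3 / 2 * ((d + 2) * G ^ 2) + (d + 34) / 48 * (θ * G) ^ 2 := by gcongr
    _ = (3 / 2 * (d + 2) + (d + 34) / 48 * θ ^ 2) * G ^ 2 := by ring
    _ ≤ (19 / 24) ^ 2 * (3 * (d + 2) + (d + 20) / 16 * θ ^ 2) * G ^ 2 := by
        gcongr
        nlinarith [mul_nonneg (by linarith : 0 ≤ d) (sq_nonneg θ), sq_nonneg θ]
    _ ≤ (19 / 24) ^ 2 * (δ * N * θ ^ 2) * G ^ 2 := by gcongr
    _ = δ * N * (19 / 24 * (θ * G)) ^ 2 := by ring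

end NumericalBounds

end GaussianSmoothing

open GaussianSmoothing MeasureTheory ProbabilityTheory Module in
theorem corollary2p7_general {E : Type*} [NormedAddCommGroup E] [InnerProductSpace ℝ E]
    [FiniteDimensional ℝ E] [MeasurableSpace E] [BorelSpace E] (hE : 1 < finrank ℝ E)
    {φ : E → ℝ} (hφ : Differentiable ℝ φ) {L : ℝ≥0} (hL : 0 < L)
    (hLip : LipschitzWith L (gradient φ)) {f : E → ℝ} (hf : Measurable f)
    {ε : ℝ} (hnoise : ∀ y, |f y - φ y| ≤ ε)
    {Ω : Type*} [MeasurableSpace Ω] {P : Measure Ω} [IsProbabilityMeasure P]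
    {N : ℕ} {u : Fin N → Ω → E} (hindep : iIndepFun u P)
    (hlaw : ∀ i, HasLaw (u i) (stdGaussian E) P) (x : E) {θ δ σ : ℝ}
    (hθ : 0 < θ) (hδ : 0 < δ) (hσ : 0 < σ)
    (hN : 3 * (finrank ℝ E : ℝ) / (δ * θ ^ 2) * (finrank ℝ E / (√(finrank ℝ E) - 1) ^ 2)
      + (finrank ℝ E + 4) / (16 * δ) + 1 / δ ≤ N)
    (hσ_lower : √(ε / L) ≤ σ)
    (hσ_upper : σ ≤ θ * ‖gradient φ x‖ / (6 * finrank ℝ E * L)) :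
    1 - δ ≤ P.real {ω | ‖(1 / (N : ℝ)) • ∑ i, differenceQuotient f σ x (u i ω) • u i ω
      - gradient φ x‖ ≤ θ * ‖gradient φ x‖} := by
  set d := (finrank ℝ E : ℝ)
  have hd : 2 ≤ d := Nat.ofNat_le_cast.2 hE
  have hL' : (0 : ℝ) < L := hL
  have hs : 0 < L * σ := by positivity
  have hε : ε ≤ L * σ ^ 2 := (div_le_iff₀' hL').1 ((Real.sqrt_le_left hσ.le).1 hσ_lower)
  have hsG : 6 * d * (L * σ) ≤ θ * ‖gradient φ x‖ := by
    rw [le_div_iff₀ (by positivity)] at hσ_upper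
    linarith
  have hG : 0 < θ * ‖gradient φ x‖ := lt_of_lt_of_le (by positivity) hsG
  have hsample := le_mul_of_sample_size (by linarith) hθ hδ hN
  have hbias := (norm_integral_differenceQuotient_smul_sub_gradient_le hφ hLip hf hnoise hσ hε
    x).trans (bias_bound_le hd hs.le hsG)
  have hmoment := (integral_norm_differenceQuotient_smul_sq_le hφ hLip hf hnoise hσ hε x).trans
    (second_moment_bound_le hd hs.le hsG hsample)
  have : NeZero N := ⟨fun h0 ↦ by
    rw [h0, Nat.cast_zero, mul_zero, zero_mul] at hsample
    nlinarith [sq_nonneg θ]⟩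
  -- The bias takes up `5 / 24` of the allowed error, which leaves `19 / 24` for the deviation.
  simpa only [Fintype.card_fin] using one_sub_le_measureReal_norm_sampleMean_sub_le
    (Y := fun u ↦ differenceQuotient f σ x u • u) hindep hlaw
    ((measurable_differenceQuotient hf σ x).smul measurable_id)
    (memLp_differenceQuotient_smul hφ hLip hf hnoise hσ hε x)
    (ρ := 19 / 24 * (θ * ‖gradient φ x‖)) (by positivity)
    (by simpa only [Fintype.card_fin] using hmoment) (y := gradient φ x)
    (r := θ * ‖gradient φ x‖) (by linarith)

theorem corollary2p7 {n N : ℕ} (hn : 1 < n)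
    -- the smooth function `φ`, with `L`-Lipschitz gradient
    (φ : EuclideanSpace ℝ (Fin n) → ℝ) (hφ : ContDiff ℝ 1 φ)
    (L : ℝ≥0) (hL : 0 < L) (hLip : LipschitzWith L (gradient φ))
    -- its approximation `f`, with noise bounded by `εf`
    (f : EuclideanSpace ℝ (Fin n) → ℝ) (hf : Measurable f)
    (εf : ℝ) (hεf : 0 ≤ εf) (hnoise : ∀ y, |f y - φ y| ≤ εf)
    -- the sampling directions: independent, each with law `𝒩(0, I)`
    {Ω : Type*} [MeasurableSpace Ω] (P : MeasureTheory.Measure Ω)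
    [MeasureTheory.IsProbabilityMeasure P]
    (u : Fin N → Ω → EuclideanSpace ℝ (Fin n))
    (hindep : ProbabilityTheory.iIndepFun u P)
    (hlaw : ∀ i, ProbabilityTheory.HasLaw (u i)
      (ProbabilityTheory.stdGaussian (EuclideanSpace ℝ (Fin n))) P)
    (x : EuclideanSpace ℝ (Fin n)) (θ δ σ : ℝ)
    (hθ : 0 < θ) (hθ1 : θ < 1) (hδ : 0 < δ) (hδ1 : δ < 1) (hσ : 0 < σ)
    (hN : 3 * (n : ℝ) / (δ * θ ^ 2) * ((n : ℝ) / (√(n : ℝ) - 1) ^ 2)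
      + ((n : ℝ) + 4) / (16 * δ) + 1 / δ ≤ (N : ℝ))
    (hσ_lower : √(εf / (L : ℝ)) ≤ σ)
    (hσ_upper : σ ≤ θ * ‖gradient φ x‖ / (6 * (n : ℝ) * (L : ℝ)))
    (hgrad : 6 * (n : ℝ) * √((L : ℝ) * εf) / θ ≤ ‖gradient φ x‖) :
    1 - δ ≤ P.real {ω |
      NormCondition φ θ (gaussianSmoothedGradient f σ (fun i => u i ω) x) x} := by
  exact corollary2p7_general (by simpa using hn) (hφ.differentiable one_ne_zero) hL hLip hf hnoise
    hindep hlaw x hθ hδ hσ (by simpa using hN) hσ_lower (by simpa using hσ_upper)
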